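/- **Model.** A network is a graph $G=(V,E)$ with finitely many links, directed or undirected, in which every link $e$ has a capacity $C(e)\ge 0$ (in an undirected graph the flows in the two directions of a link share its capacity). A finite or infinite sequence of requests $j$ is given; request $j$ arrives at a time $a_j\ge 0$ and asks to transmit a file of size $f_j>0$ from a node $s_j$ to a node $d_j\neq s_j$. The requests are listed in order of arrival, and only finitely many arrive up to any given time. For a set $L$ of requests let $\mathtt{maxflow}(G,L)\in[0,\infty]$ be the least $T$ such that all files in $L$ can be transmitted concurrently during a time of length $T$ by a multicommodity flow of constant rates (request $j$ having flow value $f_j/T$) whose total rate on each link is at most its capacity ($\infty$ if there is no such $T$). **BatchAll.** A request that arrives when no batch is running and none is pending forms a batch by itself, which starts at once. A batch with request set $L$ lasts for a time $\mathtt{maxflow}(G,L)$, and all its requests are completed at its end. The requests that arrive while a batch is running (strictly before its end) are pending; if there are any when it ends, all of them form the next batch, which starts immediately. **Offline algorithms.** An offline schedule knows all requests in advance and assigns to every request $j$ and every time $\tau$ a flow from $s_j$ to $d_j$, measurable in $\tau$ and zero before $a_j$, such that at all times the total rate on each link is at most its capacity. The waiting time of $j$ is the time from $a_j$ until an amount $f_j$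 has been transmitted. The optimal maximum waiting time is the infimum over all schedules of the supremum of the waiting times of all requests in the sequence. **Theorem.** Let $\varepsilon>0$, and let the augmented network be $G$ with the capacity of every link $e$ replaced by $(1+\varepsilon)C(e)$. Then for every time $t^*$ the maximum time from arrival to completion under BatchAll in the augmented network, over the requests arriving up to time $t^*$, is at most $2/\varepsilon$ times the optimal maximum waiting time in the original network. This holds when both BatchAll and the optimal offline algorithm are given the whole request sequence (the optimal maximum waiting time being taken over all its requests), and also when both are given only the requests that arrive up to time $t^*$. -/

import Mathlib

open scoped NNReal ENNReal

noncomputable section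

namespace AdvanceReservation

/-- A capacitated network on the node set `V` with link set `E`. The graph is directed or
undirected; in the undirected case `src e` and `dst e` are the two ends of `e` in some order. -/
structure Network (V E : Type*) where
  src : E → V
  dst : E → V
  directed : Prop
  cap : E → ℝ
  cap_nonneg : ∀ e, 0 ≤ cap e

/-- A connection request `(s, d, f)`: source, destination different from it, file size. -/
structure Job (V : Type*) where
  source : V
  dest : V
  dest_ne : dest ≠ source
  size : ℝ
  size_pos : 0 < size

/-- A finite or infinite sequence of requests, listed in the order in which they are placed
(the order of `J` matters only for simultaneous arrivals); finitely many arrive by any time. -/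
structure Requests (V J : Type*) [LinearOrder J] where
  job : J → Job V
  arrival : J → ℝ≥0
  arrival_mono : Monotone arrival
  finite_arrivals : ∀ t, {j | arrival j ≤ t}.Finite

/-- The sequence made only of the requests that arrive up to time `t`. -/
def Requests.upTo {V J : Type*} [LinearOrder J] (r : Requests V J) (t : ℝ≥0) :
    Requests V {j : J // r.arrival j ≤ t} where
  job j := r.job j
  arrival j := r.arrival j
  arrival_mono _ _ h := r.arrival_mono h
  finite_arrivals u := (r.finite_arrivals u).preimage Subtype.val_injective.injOn

namespace Network

variable {V E J : Type*}

/-- The network in which the capacity of every link is multiplied by `1 + ε`. -/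
def augment (N : Network V E) (ε : ℝ) (hε : 0 < ε) : Network V E where
  src := N.src
  dst := N.dst
  directed := N.directed
  cap e := (1 + ε) * N.cap e
  cap_nonneg e := mul_nonneg (by linarith) (N.cap_nonneg e)

/-- Node at which link `e` is entered, in the forward (`true`) or backward (`false`) sense. -/
def tail (N : Network V E) (e : E) (b : Bool) : V := if b then N.src e else N.dst e

/-- Node at which link `e` is left, in the forward (`true`) or backward (`false`) sense. -/
def head (N : Network V E) (e : E) (b : Bool) : V := if b then N.dst e else N.src e

open Classical in
/-- Outgoing minus incoming rate at the node `v`, where `x e b` is the rate sent through the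
link `e` in the sense `b`. -/
def netOut [Fintype E] (N : Network V E) (x : E → Bool → ℝ) (v : V) : ℝ :=
  ∑ e, ∑ b, ((if N.tail e b = v then x e b else 0) - (if N.head e b = v then x e b else 0))

/-- `x` is a flow from `s` to `d`; its value is `N.netOut x s`. -/
structure IsFlow [Fintype E] (N : Network V E) (s d : V) (x : E → Bool → ℝ) : Prop where
  nonneg : ∀ e b, 0 ≤ x e b
  oneWay : N.directed → ∀ e, x e false = 0
  conserved : ∀ v, v ≠ s → v ≠ d → N.netOut x v = 0
  value_nonneg : 0 ≤ N.netOut x s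

/-- `multicomm`: constant-rate concurrent flows can transmit all jobs with index in `L` during a
time of length `T`, the total flow through each link not exceeding its capacity. -/
def Multicomm [Fintype E] (N : Network V E) (job : J → Job V) (L : Set J) (T : ℝ≥0) : Prop :=
  ∃ x : J → E → Bool → ℝ,
    (∀ j ∈ L, N.IsFlow (job j).source (job j).dest (x j)) ∧
    (∀ j ∈ L, T * N.netOut (x j) (job j).source = (job j).size) ∧
    (∀ F : Finset J, (F : Set J) ⊆ L → ∀ e, ∑ j ∈ F, (x j e true + x j e false) ≤ N.cap e)

/-- `maxflow`: the least `T` for which `Multicomm` holds, `∞` if there is none. -/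
def maxflow [Fintype E] (N : Network V E) (job : J → Job V) (L : Set J) : ℝ≥0∞ :=
  ⨅ (T : ℝ≥0) (_ : N.Multicomm job L T), (T : ℝ≥0∞)

end Network

section BatchAll

variable {V E J : Type*} [LinearOrder J]

/-- State of `BatchAll` between two batches: the requests that were put into a batch so far, and
the time at which the last of these batches ends. -/
structure BatchState (J : Type*) where
  served : Set J
  clock : ℝ≥0∞

/-- The waiting batch: requests that arrived before the end of the last batch and are in no
batch so far. -/
def BatchState.pending (r : Requests V J) (st : BatchState J) : Set J :=
  {j | j ∉ st.served ∧ (r.arrival j : ℝ≥0∞) < st.clock}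

open Classical in
/-- The next batch: all pending requests or, if there is none, the next request alone. -/
def BatchState.batch (r : Requests V J) (st : BatchState J) : Set J :=
  if (st.pending r).Nonempty then st.pending r else {j | IsLeast st.servedᶜ j}

open Classical in
/-- The next batch starts when the last one ends or, if no request is pending then, at the
arrival of the next request (`∞` if no request is left). -/
def BatchState.start (r : Requests V J) (st : BatchState J) : ℝ≥0∞ :=
  if (st.pending r).Nonempty then st.clock else ⨅ j ∈ st.servedᶜ, (r.arrival j : ℝ≥0∞)

def BatchState.finish [Fintype E] (N : Network V E) (r : Requests V J) (st : BatchState J) :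
    ℝ≥0∞ :=
  st.start r + N.maxflow r.job (st.batch r)

/-- State of `BatchAll` on the network `N` after `k` batches. -/
def batchAllState [Fintype E] (N : Network V E) (r : Requests V J) : ℕ → BatchState J
  | 0 => ⟨∅, 0⟩
  | k + 1 =>
    let st := batchAllState N r k
    ⟨st.served ∪ st.batch r, st.finish N r⟩

/-- Time at which the request `j` is completed under `BatchAll`: the end of its batch. -/
def batchAllCompletion [Fintype E] (N : Network V E) (r : Requests V J) (j : J) : ℝ≥0∞ :=
  ⨅ (k : ℕ) (_ : j ∈ (batchAllState N r k).batch r), (batchAllState N r k).finish N r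

/-- Maximum time from arrival to completion under `BatchAll`, over the requests that arrive up
to time `t`. -/
def batchAllMaxWait [Fintype E] (N : Network V E) (r : Requests V J) (t : ℝ≥0) : ℝ≥0∞ :=
  ⨆ (j : J) (_ : r.arrival j ≤ t), (batchAllCompletion N r j - r.arrival j)

end BatchAll

section Offline

variable {V E J : Type*} [LinearOrder J] [Fintype E]

/-- What an arbitrary (offline) algorithm may do: `rate j τ e b` is the rate at which data of the
request `j` passes the link `e` in the sense `b` at time `τ`. Paths may be split, changed and
interrupted at will. -/
structure Schedule (N : Network V E) (r : Requests V J) where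
  rate : J → ℝ → E → Bool → ℝ
  measurable_rate : ∀ j e b, Measurable fun τ => rate j τ e b
  isFlow : ∀ j τ, N.IsFlow (r.job j).source (r.job j).dest (rate j τ)
  after_arrival : ∀ j τ, τ < r.arrival j → ∀ e b, rate j τ e b = 0
  capacity : ∀ τ (F : Finset J) e, ∑ j ∈ F, (rate j τ e true + rate j τ e false) ≤ N.cap e

/-- Time from the arrival of the request `j` until its whole file has been transmitted (`∞` if
this never happens). -/
def Schedule.wait {N : Network V E} {r : Requests V J} (σ : Schedule N r) (j : J) : ℝ≥0∞ :=
  ⨅ (w : ℝ≥0) (_ : (r.job j).size ≤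
      ∫ τ in (r.arrival j : ℝ)..(r.arrival j + w : ℝ), N.netOut (σ.rate j τ) (r.job j).source),
    (w : ℝ≥0∞)

/-- The maximum waiting time of an optimal offline algorithm. -/
def optMaxWait (N : Network V E) (r : Requests V J) : ℝ≥0∞ :=
  ⨅ σ : Schedule N r, ⨆ j, σ.wait j

end Offline

end AdvanceReservation

end

/-!
Fix an offline schedule whose waiting times are below `w`. If the requests in `L` all arrive
during `[a, a + d]`, the schedule transmits them entirely during `[a, a + d + w]`, and averaging its
rates over that interval gives constant-rate flows that do the same. Hence
`maxflow(G, L) ≤ d + OPT`, and in the augmented network this drops to `(d + OPT) / (1 + ε)`, which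
is `c` for `d = c = OPT / ε`: requests arriving within `c` of each other form a batch lasting
at most `c`.

Such a `c` sustains itself. As long as batches last at most `c`, every request waits at most `c`
for its batch to start; so the requests of the next batch arrived within `c` of each other and
that batch again lasts at most `c`. Waiting and transmission together take at most `2c`.
-/

namespace AdvanceReservation

open MeasureTheory Set
open scoped ProbabilityTheory

variable {V E J : Type*}

namespace Network

variable [Fintype E]

section Flow

variable {N : Network V E} {s d : V}

theorem netOut_add (x y : E → Bool → ℝ) (v : V) :
    N.netOut (x + y) v = N.netOut x v + N.netOut y v := by
  simp only [netOut, ← Finset.sum_add_distrib, Pi.add_apply]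
  refine Finset.sum_congr rfl fun e _ => Finset.sum_congr rfl fun b _ => ?_
  split_ifs <;> ring

theorem netOut_smul (c : ℝ) (x : E → Bool → ℝ) (v : V) :
    N.netOut (c • x) v = c * N.netOut x v := by
  simp only [netOut, Finset.mul_sum, mul_sub, mul_ite, mul_zero, Pi.smul_apply, smul_eq_mul]

/-- `Network.netOut` at a fixed node as a continuous linear functional of the rates, so that it
commutes with integrals. -/
noncomputable def netOutCLM (N : Network V E) (v : V) : (E → Bool → ℝ) →L[ℝ] ℝ :=
  LinearMap.toContinuousLinearMap
    { toFun := fun x => N.netOut x v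
      map_add' := fun x y => netOut_add x y v
      map_smul' := fun c x => netOut_smul c x v }

theorem IsFlow.smul {x : E → Bool → ℝ} (hx : N.IsFlow s d x) {c : ℝ} (hc : 0 ≤ c) :
    N.IsFlow s d (c • x) where
  nonneg e b := mul_nonneg hc (hx.nonneg e b)
  oneWay hd e := by simp only [Pi.smul_apply, hx.oneWay hd e, smul_zero]
  conserved v hs hd := by rw [netOut_smul, hx.conserved v hs hd, mul_zero]
  value_nonneg := by rw [netOut_smul]; exact mul_nonneg hc hx.value_nonneg

variable {Ω : Type*} [MeasurableSpace Ω] {μ : Measure Ω} {x : Ω → E → Bool → ℝ}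

theorem integral_rate_apply (hx : Integrable x μ) (e : E) (b : Bool) :
    (∫ ω, x ω ∂μ) e b = ∫ ω, x ω e b ∂μ := by
  rw [eval_integral hx.eval, eval_integral (hx.eval e).eval]

theorem netOut_integral (hx : Integrable x μ) (v : V) :
    N.netOut (∫ ω, x ω ∂μ) v = ∫ ω, N.netOut (x ω) v ∂μ :=
  ((N.netOutCLM v).integral_comp_comm hx).symm

theorem IsFlow.integral (hx : Integrable x μ) (h : ∀ ω, N.IsFlow s d (x ω)) :
    N.IsFlow s d (∫ ω, x ω ∂μ) where
  nonneg e b := by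
    rw [integral_rate_apply hx]
    exact integral_nonneg fun ω => (h ω).nonneg e b
  oneWay hd e := by simp only [integral_rate_apply hx, (h _).oneWay hd e, integral_zero]
  conserved v hs hd := by
    simp only [netOut_integral hx, (h _).conserved v hs hd, integral_zero]
  value_nonneg := by
    rw [netOut_integral hx]
    exact integral_nonneg fun ω => (h ω).value_nonneg

end Flow

section Maxflow

variable {N : Network V E} {job : J → Job V} {L : Set J} {T : ℝ≥0}

theorem multicomm_of_size_le {x : J → E → Bool → ℝ}
    (hflow : ∀ j ∈ L, N.IsFlow (job j).source (job j).dest (x j))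
    (hsize : ∀ j ∈ L, (job j).size ≤ T * N.netOut (x j) (job j).source)
    (hcap : ∀ F : Finset J, (F : Set J) ⊆ L → ∀ e, ∑ j ∈ F, (x j e true + x j e false) ≤ N.cap e) :
    N.Multicomm job L T := by
  set sent : J → ℝ := fun j => T * N.netOut (x j) (job j).source
  have sent_pos : ∀ j ∈ L, 0 < sent j := fun j hj => (job j).size_pos.trans_le (hsize j hj)
  refine ⟨fun j => ((job j).size / sent j) • x j, fun j hj => ?_, fun j hj => ?_,
    fun F hF e => (Finset.sum_le_sum fun j hj => ?_).trans (hcap F hF e)⟩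
  · exact (hflow j hj).smul (div_nonneg (job j).size_pos.le (sent_pos j hj).le)
  · rw [netOut_smul, mul_left_comm]
    exact div_mul_cancel₀ _ (sent_pos j hj).ne'
  · have h_ratio : (job j).size / sent j ≤ 1 := div_le_one_of_le₀ (hsize j (hF hj))
      (sent_pos j (hF hj)).le
    have h_nonneg := (hflow j (hF hj)).nonneg e
    simp only [Pi.smul_apply, smul_eq_mul, ← mul_add]
    exact mul_le_of_le_one_left (add_nonneg (h_nonneg true) (h_nonneg false)) h_ratio

theorem Multicomm.augment (h : N.Multicomm job L T) {ε : ℝ} (hε : 0 < ε) :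
    (N.augment ε hε).Multicomm job L (T / (1 + ε).toNNReal) := by
  obtain ⟨x, hflow, hsize, hcap⟩ := h
  have hε' : 0 < 1 + ε := by positivity
  have hscaled : ∀ j ∈ L, N.IsFlow (job j).source (job j).dest ((1 + ε) • x j) := fun j hj =>
    (hflow j hj).smul hε'.le
  refine ⟨fun j => (1 + ε) • x j, fun j hj => ?_, fun j hj => ?_, fun F hF e => ?_⟩
  · exact { hscaled j hj with }
  · change _ * N.netOut _ _ = _
    rw [netOut_smul, NNReal.coe_div, Real.coe_toNNReal _ hε'.le, ← mul_assoc,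
      div_mul_cancel₀ _ hε'.ne', hsize j hj]
  · simp only [Pi.smul_apply, smul_eq_mul, ← mul_add, ← Finset.mul_sum]
    exact mul_le_mul_of_nonneg_left (hcap F hF e) hε'.le

theorem maxflow_augment_le {ε : ℝ} (hε : 0 < ε) :
    (N.augment ε hε).maxflow job L ≤ N.maxflow job L / ENNReal.ofReal (1 + ε) := by
  have hne_zero : ENNReal.ofReal (1 + ε) ≠ 0 := (ENNReal.ofReal_pos.2 (by positivity)).ne'
  rw [ENNReal.le_div_iff_mul_le (.inl hne_zero) (.inl ENNReal.ofReal_ne_top)]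
  refine le_iInf₂ fun T hT => ?_
  rw [← ENNReal.le_div_iff_mul_le (.inl hne_zero) (.inl ENNReal.ofReal_ne_top)]
  refine (iInf₂_le _ (hT.augment hε)).trans_eq ?_
  exact ENNReal.coe_div (Real.toNNReal_pos.2 (by positivity)).ne'

end Maxflow

end Network

namespace Requests

variable [LinearOrder J]

/-- The arrivals of the requests in `L` are at most `d` apart. -/
def ArriveWithin (r : Requests V J) (L : Set J) (d : ℝ≥0∞) : Prop :=
  ∀ i ∈ L, ∀ j ∈ L, (r.arrival j : ℝ≥0∞) ≤ r.arrival i + d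

theorem exists_isLeast (r : Requests V J) {S : Set J} (hS : S.Nonempty) : ∃ i, IsLeast S i := by
  obtain ⟨j, hj⟩ := hS
  have hfin : (S ∩ Iic j).Finite :=
    (r.finite_arrivals (r.arrival j)).subset fun _ hi => r.arrival_mono hi.2
  obtain ⟨i, hi⟩ := hfin.exists_minimal ⟨j, hj, le_rfl⟩
  have hleast : IsLeast (S ∩ Iic j) i := minimal_iff_isLeast.1 hi
  refine ⟨i, hleast.1.1, fun k hk => ?_⟩
  rcases le_total k j with hkj | hjk
  · exact hleast.2 ⟨hk, hkj⟩
  · exact hleast.1.2.trans hjk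

theorem ArriveWithin.exists_window {r : Requests V J} {L : Set J} {d : ℝ≥0∞}
    (hL : r.ArriveWithin L d) :
    ∃ a : ℝ≥0, ∀ j ∈ L, a ≤ r.arrival j ∧ (r.arrival j : ℝ≥0∞) ≤ a + d := by
  rcases L.eq_empty_or_nonempty with rfl | hne
  · exact ⟨0, fun j hj => hj.elim⟩
  · obtain ⟨i, hi⟩ := r.exists_isLeast hne
    exact ⟨r.arrival i, fun j hj => ⟨r.arrival_mono (hi.2 hj), hL i hi.1 j hj⟩⟩

end Requests

namespace Schedule

variable [LinearOrder J] [Fintype E] {N : Network V E} {r : Requests V J}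

theorem rate_le_cap (σ : Schedule N r) (j : J) (τ : ℝ) (e : E) (b : Bool) :
    σ.rate j τ e b ≤ N.cap e := by
  have hcap := σ.capacity τ {j} e
  have h_nonneg := (σ.isFlow j τ).nonneg e
  rw [Finset.sum_singleton] at hcap
  cases b
  · linarith [h_nonneg true]
  · linarith [h_nonneg false]

theorem integrable_rate (σ : Schedule N r) (ν : Measure ℝ) [IsFiniteMeasure ν] (j : J) :
    Integrable (σ.rate j) ν := by
  refine .of_eval fun e => .of_eval fun b => .of_bound
    (σ.measurable_rate j e b).aestronglyMeasurable (N.cap e) (.of_forall fun τ => ?_)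
  rw [Real.norm_of_nonneg ((σ.isFlow j τ).nonneg e b)]
  exact σ.rate_le_cap j τ e b

/-- The constant rates obtained from a schedule by averaging over a time that is distributed
according to `ν`. -/
noncomputable def meanRate (σ : Schedule N r) (ν : Measure ℝ) (j : J) : E → Bool → ℝ :=
  ∫ τ, σ.rate j τ ∂ν

theorem isFlow_meanRate (σ : Schedule N r) (ν : Measure ℝ) [IsFiniteMeasure ν] (j : J) :
    N.IsFlow (r.job j).source (r.job j).dest (σ.meanRate ν j) :=
  Network.IsFlow.integral (σ.integrable_rate ν j) (σ.isFlow j)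

theorem sum_meanRate_le_cap (σ : Schedule N r) (ν : Measure ℝ) [IsProbabilityMeasure ν]
    (F : Finset J) (e : E) :
    ∑ j ∈ F, (σ.meanRate ν j e true + σ.meanRate ν j e false) ≤ N.cap e := by
  have hint : ∀ j b, Integrable (fun τ => σ.rate j τ e b) ν := fun j =>
    ((σ.integrable_rate ν j).eval e).eval
  calc ∑ j ∈ F, (σ.meanRate ν j e true + σ.meanRate ν j e false)
      = ∫ τ, ∑ j ∈ F, (σ.rate j τ e true + σ.rate j τ e false) ∂ν := by
        refine .symm <| (integral_finsetSum F fun j _ => (hint j true).add (hint j false)).trans <|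
          Finset.sum_congr rfl fun j _ => ?_
        simp only [meanRate, Network.integral_rate_apply (σ.integrable_rate ν j)]
        exact integral_add (hint j true) (hint j false)
    _ ≤ ∫ _, N.cap e ∂ν :=
        integral_mono (integrable_finsetSum _ fun j _ => (hint j true).add (hint j false))
          (integrable_const _) fun τ => σ.capacity τ F e
    _ = N.cap e := by rw [integral_const, probReal_univ, one_smul]

theorem intervalIntegrable_netOut (σ : Schedule N r) (j : J) (v : V) (a b : ℝ) :
    IntervalIntegrable (fun τ => N.netOut (σ.rate j τ) v) volume a b :=
  ⟨(N.netOutCLM v).integrable_comp (σ.integrable_rate _ j),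
    (N.netOutCLM v).integrable_comp (σ.integrable_rate _ j)⟩

theorem mul_netOut_meanRate_uniform (σ : Schedule N r) (j : J) (v : V) {a b : ℝ} (hab : a < b) :
    (b - a) * N.netOut (σ.meanRate volume[|Ioc a b] j) v =
      ∫ τ in a..b, N.netOut (σ.rate j τ) v := by
  rw [meanRate, Network.netOut_integral (σ.integrable_rate _ j), ProbabilityTheory.cond,
    integral_smul_measure, Real.volume_Ioc, ENNReal.toReal_inv,
    ENNReal.toReal_ofReal (sub_nonneg.2 hab.le), smul_eq_mul,
    mul_inv_cancel_left₀ (sub_pos.2 hab).ne', intervalIntegral.integral_of_le hab.le]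

theorem size_le_integral_of_wait_lt (σ : Schedule N r) {j : J} {w : ℝ≥0} (hw : σ.wait j < w)
    {a b : ℝ} (ha : a ≤ r.arrival j) (hb : r.arrival j + w ≤ b) :
    (r.job j).size ≤ ∫ τ in a..b, N.netOut (σ.rate j τ) (r.job j).source := by
  obtain ⟨u, hu⟩ := iInf_lt_iff.1 hw
  obtain ⟨hsize, huw⟩ := iInf_lt_iff.1 hu
  have huw' : (u : ℝ) < w := by exact_mod_cast huw
  exact hsize.trans (intervalIntegral.integral_mono_interval ha (le_add_of_nonneg_right u.2)
    (by linarith) (.of_forall fun τ => (σ.isFlow j τ).value_nonneg)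
    (σ.intervalIntegrable_netOut j _ a b))

theorem multicomm_of_wait_lt (σ : Schedule N r) {L : Set J} {a T w : ℝ≥0} (hT : 0 < T)
    (hw : ∀ j ∈ L, σ.wait j < w) (ha : ∀ j ∈ L, a ≤ r.arrival j)
    (haT : ∀ j ∈ L, r.arrival j + w ≤ a + T) : N.Multicomm r.job L T := by
  have hwindow : (a : ℝ) < a + T := lt_add_of_pos_right _ hT
  set ν : Measure ℝ := volume[|Ioc (a : ℝ) (a + T)]
  have : IsProbabilityMeasure ν := ProbabilityTheory.cond_isProbabilityMeasure_of_finite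
    (by simpa using hT.ne') (by simp)
  refine Network.multicomm_of_size_le (fun j _ => σ.isFlow_meanRate ν j) (fun j hj => ?_)
    fun F _ e => σ.sum_meanRate_le_cap ν F e
  have hsent := σ.mul_netOut_meanRate_uniform j (r.job j).source hwindow
  rw [add_sub_cancel_left] at hsent
  rw [hsent]
  exact σ.size_le_integral_of_wait_lt (hw j hj) (mod_cast ha j hj) (mod_cast haT j hj)

theorem maxflow_le_add_iSup_wait (σ : Schedule N r) {L : Set J} {d : ℝ≥0∞}
    (hL : r.ArriveWithin L d) : N.maxflow r.job L ≤ d + ⨆ j ∈ L, σ.wait j := by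
  obtain ⟨a, ha⟩ := hL.exists_window
  have hwait : ∀ j ∈ L, σ.wait j ≤ ⨆ j ∈ L, σ.wait j := fun j hj =>
    le_iSup₂ (f := fun j (_ : j ∈ L) => σ.wait j) j hj
  refine ENNReal.le_of_forall_pos_le_add fun δ hδ hfinite => ?_
  obtain ⟨hd, hW⟩ := ENNReal.add_lt_top.1 hfinite
  generalize (⨆ j ∈ L, σ.wait j) = W at hwait hW ⊢
  lift d to ℝ≥0 using hd.ne
  lift W to ℝ≥0 using hW.ne
  have hmulticomm : N.Multicomm r.job L (d + W + δ) := by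
    refine σ.multicomm_of_wait_lt (a := a) (w := W + δ) (by positivity) (fun j hj => ?_)
      (fun j hj => (ha j hj).1) fun j hj => ?_
    · exact (hwait j hj).trans_lt (mod_cast lt_add_of_pos_right W hδ)
    · have hlast : r.arrival j ≤ a + d := mod_cast (ha j hj).2
      calc r.arrival j + (W + δ) ≤ a + d + (W + δ) := by gcongr
        _ = a + (d + W + δ) := by ring
  exact_mod_cast iInf₂_le _ hmulticomm

end Schedule

section Offline

variable [LinearOrder J] [Fintype E] {N : Network V E} {r : Requests V J}

theorem maxflow_le_add_optMaxWait {L : Set J} {d : ℝ≥0∞} (hL : r.ArriveWithin L d) :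
    N.maxflow r.job L ≤ d + optMaxWait N r := by
  rw [optMaxWait, ENNReal.add_iInf]
  exact le_iInf fun σ => (σ.maxflow_le_add_iSup_wait hL).trans
    (add_le_add le_rfl (iSup₂_le_iSup (· ∈ L) σ.wait))

/-- Requests that arrive within `c` of each other can be transmitted in a time of length `c`. This
is what keeps the batches of `BatchAll` at a length of at most `c`. -/
def Sustainable (N : Network V E) (r : Requests V J) (c : ℝ≥0∞) : Prop :=
  ∀ L, r.ArriveWithin L c → N.maxflow r.job L ≤ c

theorem sustainable_augment (N : Network V E) (r : Requests V J) {ε : ℝ} (hε : 0 < ε) :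
    Sustainable (N.augment ε hε) r (optMaxWait N r / ENNReal.ofReal ε) := by
  intro L hL
  set c := optMaxWait N r / ENNReal.ofReal ε
  have hopt : optMaxWait N r = c * ENNReal.ofReal ε :=
    (ENNReal.div_mul_cancel (ENNReal.ofReal_pos.2 hε).ne' ENNReal.ofReal_ne_top).symm
  calc (N.augment ε hε).maxflow r.job L
      ≤ N.maxflow r.job L / ENNReal.ofReal (1 + ε) := Network.maxflow_augment_le hε
    _ ≤ (c + optMaxWait N r) / ENNReal.ofReal (1 + ε) := by
        gcongr
        exact maxflow_le_add_optMaxWait hL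
    _ = c * ENNReal.ofReal (1 + ε) / ENNReal.ofReal (1 + ε) := by
        rw [hopt, ENNReal.ofReal_add zero_le_one hε.le, ENNReal.ofReal_one, mul_add, mul_one]
    _ = c := ENNReal.mul_div_cancel_right (ENNReal.ofReal_pos.2 (by positivity)).ne'
        ENNReal.ofReal_ne_top

end Offline

namespace BatchState

variable [LinearOrder J] {r : Requests V J} {st : BatchState J} {c : ℝ≥0∞} {j : J}

theorem notMem_served_of_mem_batch (hj : j ∈ st.batch r) : j ∉ st.served := by
  unfold batch at hj
  split_ifs at hj
  exacts [hj.1, hj.1]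

theorem exists_mem_batch_arrival_le (hj : j ∉ st.served) :
    ∃ i ∈ st.batch r, r.arrival i ≤ r.arrival j := by
  unfold batch
  split_ifs with hpending
  · by_cases hj_early : (r.arrival j : ℝ≥0∞) < st.clock
    · exact ⟨j, ⟨hj, hj_early⟩, le_rfl⟩
    · obtain ⟨i, hi⟩ := hpending
      exact ⟨i, hi, mod_cast (hi.2.trans_le (not_lt.1 hj_early)).le⟩
  · obtain ⟨i, hi⟩ := r.exists_isLeast (S := st.servedᶜ) ⟨j, hj⟩
    exact ⟨i, hi, r.arrival_mono (hi.2 hj)⟩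

theorem start_le_arrival_of_notMem_batch (hj : j ∉ st.served) (hjb : j ∉ st.batch r) :
    st.start r ≤ r.arrival j := by
  unfold start
  split_ifs with hpending
  · rw [batch, if_pos hpending] at hjb
    exact not_lt.1 fun hj_early => hjb ⟨hj, hj_early⟩
  · exact iInf₂_le j hj

/-- Every request that is in no batch so far has been waiting for at most `c` when the last batch
ends. -/
def LagLE (r : Requests V J) (st : BatchState J) (c : ℝ≥0∞) : Prop :=
  ∀ j ∉ st.served, st.clock ≤ r.arrival j + c

theorem LagLE.start_le (h : st.LagLE r c) (hj : j ∉ st.served) :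
    st.start r ≤ r.arrival j + c := by
  unfold start
  split_ifs
  · exact h j hj
  · exact (iInf₂_le j hj).trans le_self_add

theorem LagLE.arriveWithin_batch (h : st.LagLE r c) : r.ArriveWithin (st.batch r) c := by
  unfold batch
  split_ifs
  · exact fun i hi j hj => hj.2.le.trans (h i hi.1)
  · intro i hi j hj
    rw [hj.unique hi]
    exact le_self_add

variable [Fintype E] {N : Network V E}

theorem LagLE.next (h : st.LagLE r c) (hc : Sustainable N r c) :
    LagLE r ⟨st.served ∪ st.batch r, st.finish N r⟩ c := by
  intro j hj
  obtain ⟨hjs, hjb⟩ := not_or.1 hj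
  exact add_le_add (start_le_arrival_of_notMem_batch hjs hjb) (hc _ h.arriveWithin_batch)

end BatchState

section BatchAll

variable [LinearOrder J] [Fintype E] {N : Network V E} {r : Requests V J} {c : ℝ≥0∞}

theorem monotone_served (N : Network V E) (r : Requests V J) :
    Monotone fun k => (batchAllState N r k).served :=
  monotone_nat_of_le_succ fun _ => subset_union_left

theorem notMem_batch_of_mem_batch_of_lt {j : J} {k l : ℕ} (hkl : k < l)
    (hj : j ∈ (batchAllState N r k).batch r) : j ∉ (batchAllState N r l).batch r :=
  fun hjl => BatchState.notMem_served_of_mem_batch hjl (monotone_served N r hkl (Or.inr hj))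

theorem notMem_served_of_forall_notMem_batch {j : J}
    (hj : ∀ k, j ∉ (batchAllState N r k).batch r) (k : ℕ) :
    j ∉ (batchAllState N r k).served := by
  induction k with
  | zero => exact notMem_empty j
  | succ k ih => exact not_or.2 ⟨ih, hj k⟩

theorem exists_mem_batch (N : Network V E) (r : Requests V J) (j : J) :
    ∃ k, j ∈ (batchAllState N r k).batch r := by
  by_contra! hj
  choose i hi_batch hi_arrival using fun k =>
    BatchState.exists_mem_batch_arrival_le (r := r) (notMem_served_of_forall_notMem_batch hj k)
  have hi_injective : Function.Injective i := .of_lt_imp_ne fun k l hkl hikl =>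
    notMem_batch_of_mem_batch_of_lt hkl (hi_batch k) (hikl ▸ hi_batch l)
  exact infinite_of_injective_forall_mem hi_injective hi_arrival (r.finite_arrivals (r.arrival j))

theorem lagLE_batchAllState (hc : Sustainable N r c) (k : ℕ) :
    (batchAllState N r k).LagLE r c := by
  induction k with
  | zero => exact fun j _ => zero_le
  | succ k ih => exact ih.next hc

theorem batchAllCompletion_le (hc : Sustainable N r c) (j : J) :
    batchAllCompletion N r j ≤ r.arrival j + 2 * c := by
  obtain ⟨k, hj⟩ := exists_mem_batch N r j
  have hlag := lagLE_batchAllState hc k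
  calc batchAllCompletion N r j
      ≤ (batchAllState N r k).finish N r := iInf₂_le k hj
    _ ≤ r.arrival j + c + c := add_le_add
        (hlag.start_le (BatchState.notMem_served_of_mem_batch hj)) (hc _ hlag.arriveWithin_batch)
    _ = r.arrival j + 2 * c := by rw [two_mul, add_assoc]

theorem batchAllMaxWait_le (hc : Sustainable N r c) (t : ℝ≥0) :
    batchAllMaxWait N r t ≤ 2 * c :=
  iSup₂_le fun j _ => tsub_le_iff_left.2 (batchAllCompletion_le hc j)

theorem batchAllMaxWait_augment_le (N : Network V E) (r : Requests V J) {ε : ℝ} (hε : 0 < ε)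
    (t : ℝ≥0) :
    batchAllMaxWait (N.augment ε hε) r t ≤ ENNReal.ofReal (2 / ε) * optMaxWait N r :=
  calc batchAllMaxWait (N.augment ε hε) r t
      ≤ 2 * (optMaxWait N r / ENNReal.ofReal ε) :=
        batchAllMaxWait_le (sustainable_augment N r hε) t
    _ = ENNReal.ofReal (2 / ε) * optMaxWait N r := by
        rw [ENNReal.ofReal_div_of_pos hε, ENNReal.ofReal_ofNat, ← mul_div_assoc,
          ENNReal.mul_div_right_comm]

end BatchAll

end AdvanceReservation

theorem mainTheorem1 {V E J : Type*} [Fintype E] [LinearOrder J]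
    (N : AdvanceReservation.Network V E) (r : AdvanceReservation.Requests V J)
    (ε : ℝ) (hε : 0 < ε) (t : ℝ≥0) :
    AdvanceReservation.batchAllMaxWait (N.augment ε hε) r t
        ≤ ENNReal.ofReal (2 / ε) * AdvanceReservation.optMaxWait N r ∧
      AdvanceReservation.batchAllMaxWait (N.augment ε hε) (r.upTo t) t
        ≤ ENNReal.ofReal (2 / ε) * AdvanceReservation.optMaxWait N (r.upTo t) :=
  ⟨AdvanceReservation.batchAllMaxWait_augment_le N r hε t,
    AdvanceReservation.batchAllMaxWait_augment_le N (r.upTo t) hε t⟩
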